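/- Let $S$ be a cancellative semigroup with identity that satisfies Clifford's condition: for all $s,t\in S$, either $sS\cap tS=\varnothing$ or $sS\cap tS=rS$ for some $r\in S$. Let $I_l(S)$ be the left inverse hull of $S$, i.e. the inverse semigroup of partial bijections of $S$ generated by the maps $\lambda_s:S\to sS$, $\lambda_s(t)=st$; its zero $0$ is the empty map, if the empty map belongs to $I_l(S)$. Let $J(S)$ be the family of constructible right ideals of $S$, i.e. of all finite intersections of sets $t_1^{-1}s_1\cdots t_n^{-1}s_nS$ with $n\ge 1$, $s_i,t_i\in S$, where $sX=\{sx:x\in X\}$ and $t^{-1}X=\{x:tx\in X\}$. Let $C^*_r(S)\subset B(\ell^2(S))$ be the $C^*$-algebra generated by the isometries $V_s\varepsilon_t=\varepsilon_{st}$, where $(\varepsilon_t)_{t\in S}$ is the canonical basis. Let $\Lambda$ be the left regular representation of $I_l(S)$ on $\ell^2(I_l(S))$, given by $\Lambda(f)\delta_g=\delta_{fg}$ if $f^*fg=g$ and $\Lambda(f)\delta_g=0$ otherwise, let $C^*_r(I_l(S))$ be the $C^*$-algebra generated by its image, and let $C^*_{r,0}(I_l(S))=C^*_r(I_l(S))/\mathbb{C}\Lambda(0)$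 (and $C^*_{r,0}(I_l(S))=C^*_r(I_l(S))$ if $I_l(S)$ has no zero). Let $T:\ell^2(S)\to\ell^2(I_l(S))$ be the isometry $T\varepsilon_s=\delta_{\lambda_s}$, and let $h:C^*_{r,0}(I_l(S))\to C^*_r(S)$ be the $*$-homomorphism induced by $a\mapsto T^*aT$; it satisfies $h([\Lambda(f)])\varepsilon_s=\varepsilon_{f(s)}$ if $s\in\operatorname{dom}(f)$ and $h([\Lambda(f)])\varepsilon_s=0$ otherwise, for all $f\in I_l(S)$ and $s\in S$. Then: (i) $I_l(S)$ is $E^*$-unitary: if $f,g\in I_l(S)$, $fg=g$ and $g\neq 0$, then $f$ is idempotent; (ii) $J(S)$ is independent: if $X_1,\dots,X_n,Y\in J(S)$, $n\ge 1$, and $X_1\cup\dots\cup X_n=Y$, then $X_i=Y$ for some $i$; (iii) $h$ is well defined and is an (isometric) $*$-isomorphism of $C^*_{r,0}(I_l(S))$ onto $C^*_r(S)$. -/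

import Mathlib

open scoped ENNReal

noncomputable section

namespace LeftHull

/-! ### Inverse semigroups (with identity) -/

/-- An inverse semigroup with identity: every `p` has a unique `star p` with
`p * star p * p = p` and `star p * p * star p = star p`. -/
class InverseSemigroup (P : Type*) extends Monoid P, Star P where
  mul_star_mul : ∀ p : P, p * star p * p = p
  star_mul_star : ∀ p : P, star p * p * star p = star p
  star_unique : ∀ p q : P, p * q * p = p → q * p * q = q → q = star p

/-- The partially defined bijective maps on `X` (`none` encodes "undefined"). -/
def PartialBij (X : Type*) : Type _ := PEquiv X X

/-- `I(X)` is a monoid under composition: `f * g` is "first `g`, then `f`", and the involution is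
inversion. -/
instance (X : Type*) : Monoid (PartialBij X) where
  mul f g := PEquiv.trans g f
  one := PEquiv.refl X
  mul_assoc f g h := (PEquiv.trans_assoc h g f).symm
  one_mul f := PEquiv.trans_refl f
  mul_one f := PEquiv.refl_trans f

instance (X : Type*) : Star (PartialBij X) where
  star f := PEquiv.symm f

namespace PartialBij

variable {X : Type*}

/-- The underlying partial map of an element of `I(X)`. -/
def app (f : PartialBij X) : X → Option X := PEquiv.toFun f

/-- The empty partial map, the zero of `I(X)`. -/
def empty : PartialBij X := (⊥ : PEquiv X X)

theorem ext_iff_app {f g : PartialBij X} : f = g ↔ ∀ x y, f.app x = some y ↔ g.app x = some y := by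
  refine ⟨fun h => by simp [h], fun h => PEquiv.ext fun x => Option.ext fun y => h x y⟩

theorem mul_app {f g : PartialBij X} {x z : X} :
    (f * g).app x = some z ↔ ∃ y, g.app x = some y ∧ f.app y = some z :=
  PEquiv.trans_eq_some g f x z

theorem star_app {f : PartialBij X} {x y : X} :
    (star f).app x = some y ↔ f.app y = some x :=
  PEquiv.eq_some_iff f

theorem empty_mul (f : PartialBij X) : empty * f = empty := PEquiv.trans_bot f

theorem mul_empty (f : PartialBij X) : f * empty = empty := PEquiv.bot_trans f

theorem star_mul' (f g : PartialBij X) : star (f * g) = star g * star f :=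
  PEquiv.symm_trans_rev g f

theorem mul_star_mul (f : PartialBij X) : f * star f * f = f := by
  rw [ext_iff_app]
  intro x y
  constructor
  · intro h
    obtain ⟨a, ha, h2⟩ := mul_app.1 h
    obtain ⟨b, hb, h3⟩ := mul_app.1 h2
    have h1 := star_app.2 ha
    rw [hb] at h1
    rw [← Option.some.inj h1]
    exact h3
  · intro h
    exact mul_app.2 ⟨y, h, mul_app.2 ⟨x, star_app.2 h, h⟩⟩

theorem le_of_mul {f g : PartialBij X} (h : f * g * f = f) {x y : X} (hxy : f.app x = some y) :
    g.app y = some x := by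
  have h1 := hxy
  rw [← h] at h1
  obtain ⟨a, ha, h3⟩ := mul_app.1 h1
  obtain ⟨b, hb, h4⟩ := mul_app.1 h3
  rw [hxy] at ha
  have h2 := star_app.2 h4
  rw [star_app.2 hxy] at h2
  rw [Option.some.inj ha, hb, Option.some.inj h2]

theorem star_unique {f g : PartialBij X} (h1 : f * g * f = f) (h2 : g * f * g = g) :
    g = star f := by
  rw [ext_iff_app]
  intro x y
  rw [star_app]
  exact ⟨fun h => le_of_mul h2 h, fun h => le_of_mul h1 h⟩

end PartialBij

/-! ### The partial bijection and the operator on `ℓ²` attached to an injection -/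

open Classical in
/-- An injective map, seen as a bijection from its domain onto its range. -/
def ofInjective {X Y : Type*} (g : X → Y) (hg : Function.Injective g) : PEquiv X Y where
  toFun x := some (g x)
  invFun y := if h : ∃ x, g x = y then some h.choose else none
  inv x y := by
    constructor
    · intro h
      split_ifs at h with h'
      · rw [← h'.choose_spec, Option.some.inj h]
    · intro h
      have h' : ∃ x, g x = y := ⟨x, Option.some.inj h⟩
      rw [dif_pos h']
      exact congrArg some (hg (h'.choose_spec.trans (Option.some.inj h).symm))

/-- The Hilbert space `ℓ²(X)`. -/
abbrev ell2 (X : Type*) : Type _ := lp (fun _ : X => ℂ) 2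

/-- The canonical orthonormal basis of `ℓ²(X)`. -/
def basisVec {X : Type*} (x : X) : ell2 X := by
  classical exact lp.single 2 x (1 : ℂ)

variable {X Y : Type*}

/-- Extension by zero of `ξ ∘ f⁻¹`. -/
def push (f : PEquiv X Y) (ξ : X → ℂ) (y : Y) : ℂ := (f.symm y).elim 0 ξ

theorem sum_push_le (f : PEquiv X Y) (ξ : ell2 X) (s : Finset Y) :
    ∑ y ∈ s, ‖push f ξ y‖ ^ (2 : ℝ≥0∞).toReal ≤ ‖ξ‖ ^ (2 : ℝ≥0∞).toReal := by
  classical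
  have h0 : (0 : ℝ) < (2 : ℝ≥0∞).toReal := by norm_num
  let t : Finset Y := s.filter fun y => (f.symm y).isSome
  have ht : ∑ y ∈ s, ‖push f ξ y‖ ^ (2 : ℝ≥0∞).toReal =
      ∑ y ∈ t, ‖push f ξ y‖ ^ (2 : ℝ≥0∞).toReal := by
    symm
    refine Finset.sum_filter_of_ne fun y _ hy => ?_
    by_contra h
    apply hy
    have : f.symm y = none := by simpa using h
    simp [push, this]
  rw [ht]
  have hmem : ∀ y ∈ t, (f.symm y).isSome := fun y hy => (Finset.mem_filter.1 hy).2
  rw [← Finset.sum_attach]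
  let g : {y // y ∈ t} → X := fun y => (f.symm y.1).get (hmem _ y.2)
  have hg : ∀ y, f.symm y.1 = some (g y) := fun y => by simp [g]
  have ginj : Function.Injective g := by
    intro a b hab
    have h1 := (f.eq_some_iff).1 (hg a)
    have h2 := (f.eq_some_iff).1 (hg b)
    rw [hab, h2] at h1
    exact Subtype.ext (Option.some.inj h1).symm
  calc ∑ y ∈ t.attach, ‖push f ξ y.1‖ ^ (2 : ℝ≥0∞).toReal
      = ∑ y ∈ t.attach, ‖ξ (g y)‖ ^ (2 : ℝ≥0∞).toReal := by
        refine Finset.sum_congr rfl fun y _ => ?_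
        simp only [push, hg y, Option.elim_some]
    _ = ∑ x ∈ t.attach.map ⟨g, ginj⟩, ‖ξ x‖ ^ (2 : ℝ≥0∞).toReal := by
        rw [Finset.sum_map]; rfl
    _ ≤ ‖ξ‖ ^ (2 : ℝ≥0∞).toReal := lp.sum_rpow_le_norm_rpow h0 ξ _

/-- The partial isometry `ℓ²(X) → ℓ²(Y)` attached to a partially defined injection `f`: it sends
the basis vector at `x` to the one at `f x` if `f x` is defined, and to `0` otherwise. -/
def op (f : PEquiv X Y) : ell2 X →L[ℂ] ell2 Y :=
  LinearMap.mkContinuous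
    { toFun := fun ξ => ⟨push f ξ, memℓp_gen' (sum_push_le f ξ)⟩
      map_add' := fun ξ η => by
        ext y
        change push f (⇑(ξ + η)) y = push f ξ y + push f η y
        unfold push
        rw [lp.coeFn_add]
        cases f.symm y <;> simp
      map_smul' := fun c ξ => by
        ext y
        change push f (⇑(c • ξ)) y = c * push f ξ y
        unfold push
        cases f.symm y <;> simp }
    1
    (fun ξ => by
      rw [one_mul]
      exact lp.norm_le_of_forall_sum_le (by norm_num) (norm_nonneg _) (sum_push_le f ξ))

theorem op_apply (f : PEquiv X Y) (ξ : ell2 X) (y : Y) :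
    op f ξ y = (f.symm y).elim 0 ξ := rfl

theorem op_basisVec (f : PEquiv X Y) (x : X) :
    op f (basisVec x) = (f x).elim 0 basisVec := by
  classical
  ext y
  rw [op_apply]
  rcases hy : f.symm y with _ | x'
  · rcases hx : f x with _ | y'
    · simp
    · have : y ≠ y' := by
        rintro rfl
        rw [← f.eq_some_iff, hy] at hx
        simp at hx
      simp [basisVec, lp.single_apply, this]
  · have h1 := (f.eq_some_iff).1 hy
    rcases hx : f x with _ | y'
    · have : x' ≠ x := by
        rintro rfl
        simp [hx] at h1
      simp [basisVec, lp.single_apply, this]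
    · have : x' = x ↔ y = y' := by
        constructor
        · rintro rfl
          rw [hx] at h1
          exact (Option.some.inj h1).symm
        · rintro rfl
          rw [← f.eq_some_iff, hy] at hx
          exact Option.some.inj hx
      simp [basisVec, lp.single_apply, Pi.single_apply, this]

theorem inner_op (f : PEquiv X X) (ξ η : ell2 X) :
    inner ℂ (op f ξ) η = inner ℂ ξ (op f.symm η) := by
  classical
  rw [lp.inner_eq_tsum, lp.inner_eq_tsum]
  have key : ∀ (g : PEquiv X X) (x : X) (u v : ell2 X),
      inner ℂ (op g u x) (v x) ≠ 0 → (g.symm x).isSome := by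
    intro g x u v h
    by_contra h'
    have : g.symm x = none := by simpa using h'
    simp [op_apply, this] at h
  have key' : ∀ x, inner ℂ (ξ x) (op f.symm η x) ≠ 0 → (f x).isSome := by
    intro x h
    by_contra h'
    have : f x = none := by simpa using h'
    simp [op_apply, this] at h
  refine (tsum_eq_tsum_of_ne_zero_bij
    (fun x : Function.support (fun x => inner ℂ (ξ x) (op f.symm η x)) =>
      (f x.1).get (key' x.1 x.2)) ?_ ?_ ?_)
  · intro a b hab
    simp only at hab
    have ha : f a.1 = some ((f a.1).get (key' a.1 a.2)) := by simp
    have hb : f b.1 = some ((f b.1).get (key' b.1 b.2)) := by simp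
    rw [hab] at ha
    rw [← f.eq_some_iff] at ha hb
    rw [hb] at ha
    exact Subtype.ext (Option.some.inj ha).symm
  · intro y hy
    have hs := key f y ξ η hy
    obtain ⟨x, hx⟩ := Option.isSome_iff_exists.1 hs
    have hx' := (f.eq_some_iff).1 hx
    refine ⟨⟨x, ?_⟩, ?_⟩
    · simpa [op_apply, hx, hx'] using hy
    · simp [hx']
  · intro x
    obtain ⟨y, hy⟩ := Option.isSome_iff_exists.1 (key' x.1 x.2)
    have hy' := (f.eq_some_iff).2 hy
    simp [op_apply, hy, hy']

theorem star_op (f : PEquiv X X) : star (op f) = op f.symm := by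
  rw [ContinuousLinearMap.star_eq_adjoint]
  symm
  rw [ContinuousLinearMap.eq_adjoint_iff]
  intro ξ η
  rw [inner_op, PEquiv.symm_symm]

/-! ### The left regular representation and the reduced C*-algebra of an inverse semigroup -/

section Reduced

variable (P : Type*) [InverseSemigroup P]

variable {P} in
open Classical in
/-- The Wagner–Preston partial bijection `q ↦ p * q`, with domain `{q | star p * p * q = q}`. -/
def wagnerPreston (p : P) : PEquiv P P where
  toFun q := if star p * p * q = q then some (p * q) else none
  invFun r := if p * star p * r = r then some (star p * r) else none
  inv q r := by
    constructor
    · intro h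
      split_ifs at h with h1
      obtain rfl := Option.some.inj h
      have : star p * p * (star p * r) = star p * r := by
        rw [← mul_assoc, InverseSemigroup.star_mul_star]
      rw [if_pos this, ← mul_assoc, h1]
    · intro h
      split_ifs at h with h1
      obtain rfl := Option.some.inj h
      have : p * star p * (p * q) = p * q := by
        rw [← mul_assoc, InverseSemigroup.mul_star_mul]
      rw [if_pos this, ← mul_assoc, h1]

variable {P} in
/-- The left regular representation on `ℓ²(P)`: `Λ(p) δ_q = δ_{pq}` if `p* p q = q`, and
`Λ(p) δ_q = 0` otherwise. -/
def regRep (p : P) : ell2 P →L[ℂ] ell2 P := op (wagnerPreston p)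

open Classical in
theorem regRep_apply {P : Type*} [InverseSemigroup P] (p : P) (ξ : ell2 P) (q : P) :
    regRep p ξ q = if p * star p * q = q then ξ (star p * q) else 0 := by
  rw [regRep, op_apply]
  change (if p * star p * q = q then some (star p * q) else none).elim 0 ξ = _
  split_ifs <;> rfl

open Classical in
theorem regRep_basisVec {P : Type*} [InverseSemigroup P] (p q : P) :
    regRep p (basisVec q) = if star p * p * q = q then basisVec (p * q) else 0 := by
  rw [regRep, op_basisVec]
  change (if star p * p * q = q then some (p * q) else none).elim 0 basisVec = _
  split_ifs <;> rfl

/-- The reduced C*-algebra `C*_r(P)`, the closed `*`-subalgebra of `B(ℓ²(P))` generated by the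
operators `Λ(p)` (the linear span of these is already a unital `*`-algebra). -/
def redAlg : StarSubalgebra ℂ (ell2 P →L[ℂ] ell2 P) :=
  (StarAlgebra.adjoin ℂ (Set.range (regRep (P := P)))).topologicalClosure

variable {P}

theorem regRep_mem (p : P) : regRep p ∈ redAlg P :=
  StarSubalgebra.le_topologicalClosure _ (StarAlgebra.subset_adjoin ℂ _ ⟨p, rfl⟩)

/-- `Λ(p)` as an element of `C*_r(P)`. -/
def regGen (p : P) : redAlg P := ⟨regRep p, regRep_mem p⟩

theorem star_star' (p : P) : star (star p) = p :=
  (InverseSemigroup.star_unique (star p) p (InverseSemigroup.star_mul_star p)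
    (InverseSemigroup.mul_star_mul p)).symm

open Classical in
theorem star_regRep (p : P) : star (regRep p) = regRep (star p) := by
  rw [regRep, star_op, regRep]
  congr 1
  refine PEquiv.ext fun q => ?_
  change (if p * star p * q = q then some (star p * q) else none) =
    (if star (star p) * star p * q = q then some (star p * q) else none)
  rw [star_star']

end Reduced

/-! ### The left inverse hull and the algebras of a left cancellative semigroup -/

section Hull

variable (S : Type*) [Monoid S] [IsLeftCancelMul S]

variable {S} in
/-- `λ_s : S → sS`, `t ↦ s * t`, as a partial bijection of `S`. -/
def lam (s : S) : PartialBij S := ofInjective (fun t => s * t) (mul_right_injective s)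

/-- The left inverse hull `I_l(S)`: the inverse subsemigroup of `I(S)` generated by the `λ_s`. -/
def leftInverseHull : Submonoid (PartialBij S) :=
  Submonoid.closure (Set.range lam ∪ star '' Set.range lam)

theorem star_mem_hull {f : PartialBij S} (hf : f ∈ leftInverseHull S) :
    star f ∈ leftInverseHull S := by
  induction hf using Submonoid.closure_induction with
  | mem f hf =>
    refine Submonoid.subset_closure ?_
    rcases hf with hf | ⟨g, hg, rfl⟩
    · exact Or.inr ⟨f, hf, rfl⟩
    · exact Or.inl hg
  | one => exact one_mem (leftInverseHull S)
  | mul f g _ _ hf hg =>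
    rw [PartialBij.star_mul']
    exact mul_mem hg hf

instance : InverseSemigroup (leftInverseHull S) where
  star f := ⟨star f.1, star_mem_hull S f.2⟩
  mul_star_mul f := Subtype.ext (PartialBij.mul_star_mul f.1)
  star_mul_star f := Subtype.ext (PartialBij.mul_star_mul (star f.1))
  star_unique _ _ h1 h2 := Subtype.ext
    (PartialBij.star_unique (congrArg Subtype.val h1) (congrArg Subtype.val h2))

variable {S} in
/-- `λ_s` as an element of `I_l(S)`. -/
def lamHull (s : S) : leftInverseHull S :=
  ⟨lam s, Submonoid.subset_closure (Or.inl ⟨s, rfl⟩)⟩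

variable {S} in
/-- `f` is the zero of `I_l(S)`, i.e. the empty map. (The empty map need not belong to `I_l(S)`;
if it does not, then `I_l(S)` is regarded as having no zero.) -/
def IsZeroMap (f : leftInverseHull S) : Prop := f.1 = PartialBij.empty

/-- The subspace `Λ(ℂ 0)` of `C*_r(I_l(S))`; it is `0` if `I_l(S)` has no zero. -/
def zeroSpan : Submodule ℂ (redAlg (leftInverseHull S)) :=
  Submodule.span ℂ {a | ∃ z : leftInverseHull S, IsZeroMap z ∧ a = regGen z}

variable {S} in
theorem IsZeroMap.mul_left {z : leftInverseHull S} (hz : IsZeroMap z) (f : leftInverseHull S) :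
    f * z = z := Subtype.ext (by
  change f.1 * z.1 = z.1
  rw [show z.1 = PartialBij.empty from hz, PartialBij.mul_empty])

variable {S} in
theorem IsZeroMap.mul_right {z : leftInverseHull S} (hz : IsZeroMap z) (f : leftInverseHull S) :
    z * f = z := Subtype.ext (by
  change z.1 * f.1 = z.1
  rw [show z.1 = PartialBij.empty from hz, PartialBij.empty_mul])

variable {S} in
theorem IsZeroMap.star {z : leftInverseHull S} (hz : IsZeroMap z) : star z = z := by
  have h := InverseSemigroup.star_mul_star z
  rw [hz.mul_left, hz.mul_right] at h
  exact h.symm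

theorem regRep_basisVec_zero {z : leftInverseHull S} (hz : IsZeroMap z) (f : leftInverseHull S) :
    regRep f (basisVec z) = basisVec z := by
  rw [regRep_basisVec, hz.mul_left, hz.mul_left, if_pos rfl]

theorem regRep_zero {z : leftInverseHull S} (hz : IsZeroMap z) (ξ : ell2 (leftInverseHull S)) :
    regRep z ξ = ξ z • basisVec z := by
  ext q
  rw [regRep_apply, hz.star, hz.mul_right z, hz.mul_right q]
  by_cases h : z = q
  · subst h
    simp [basisVec]
  · rw [if_neg h]
    simp [basisVec, lp.single_apply, Ne.symm h]

theorem mem_adjoin_zero {z : leftInverseHull S} (hz : IsZeroMap z)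
    {a : ell2 (leftInverseHull S) →L[ℂ] ell2 (leftInverseHull S)}
    (ha : a ∈ redAlg (leftInverseHull S)) : ∃ c : ℂ, a (basisVec z) = c • basisVec z := by
  let W : Submodule ℂ (ell2 (leftInverseHull S)) := Submodule.span ℂ {basisVec z}
  have hz0 : basisVec z ∈ W := Submodule.mem_span_singleton_self _
  let R : Set (ell2 (leftInverseHull S) →L[ℂ] ell2 (leftInverseHull S)) :=
    Set.range (regRep (P := leftInverseHull S))
  have hcl : IsClosed {b : ell2 (leftInverseHull S) →L[ℂ] ell2 (leftInverseHull S) |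
      b (basisVec z) ∈ W} :=
    (Submodule.closed_of_finiteDimensional W).preimage
      (ContinuousLinearMap.apply ℂ _ (basisVec z)).continuous
  have hstar : star R ⊆ R := by
    rintro x ⟨p, hp⟩
    exact ⟨star p, by rw [← star_regRep, hp, star_star]⟩
  have hsub : ∀ b ∈ Algebra.adjoin ℂ R, b (basisVec z) ∈ W := by
    intro b hb
    induction hb using Algebra.adjoin_induction with
    | mem x hx =>
      obtain ⟨p, rfl⟩ := hx
      rw [regRep_basisVec_zero S hz]
      exact hz0
    | algebraMap r =>
      rw [Algebra.algebraMap_eq_smul_one]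
      exact Submodule.smul_mem W r hz0
    | add x y _ _ h1 h2 => exact Submodule.add_mem W h1 h2
    | mul x y _ _ h1 h2 =>
      obtain ⟨c, hc⟩ := Submodule.mem_span_singleton.1 h2
      change x (y (basisVec z)) ∈ W
      rw [← hc, map_smul]
      exact Submodule.smul_mem W c h1
  have hsub' : ((StarAlgebra.adjoin ℂ R : StarSubalgebra ℂ _) : Set _) ⊆
      {b : ell2 (leftInverseHull S) →L[ℂ] ell2 (leftInverseHull S) | b (basisVec z) ∈ W} := by
    intro b hb
    have h3 : b ∈ (StarAlgebra.adjoin ℂ R).toSubalgebra := hb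
    rw [StarAlgebra.adjoin_toSubalgebra, Set.union_eq_left.2 hstar] at h3
    exact hsub b h3
  obtain ⟨c, hc⟩ := Submodule.mem_span_singleton.1 (closure_minimal hsub' hcl ha)
  exact ⟨c, hc.symm⟩

theorem mul_regGen_zero {z : leftInverseHull S} (hz : IsZeroMap z)
    (a : redAlg (leftInverseHull S)) : ∃ c : ℂ, a * regGen z = c • regGen z := by
  obtain ⟨c, hc⟩ := mem_adjoin_zero S hz a.2
  refine ⟨c, Subtype.ext (ContinuousLinearMap.ext fun ξ => ?_)⟩
  change a.1 (regRep z ξ) = c • regRep z ξ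
  rw [regRep_zero S hz, map_smul, hc, smul_comm]

theorem star_regGen_zero {z : leftInverseHull S} (hz : IsZeroMap z) :
    star (regGen z) = regGen z := by
  refine Subtype.ext ?_
  change star (regRep z) = regRep z
  rw [star_regRep, hz.star]

theorem star_mem_zeroSpan {a : redAlg (leftInverseHull S)} (ha : a ∈ zeroSpan S) :
    star a ∈ zeroSpan S := by
  induction ha using Submodule.span_induction with
  | mem x hx =>
    obtain ⟨z, hz, rfl⟩ := hx
    rw [star_regGen_zero S hz]
    exact Submodule.subset_span ⟨z, hz, rfl⟩
  | zero => rw [star_zero]; exact zero_mem _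
  | add x y _ _ h1 h2 => rw [star_add]; exact add_mem h1 h2
  | smul c x _ h => rw [star_smul]; exact Submodule.smul_mem _ _ h

theorem mul_mem_zeroSpan (b : redAlg (leftInverseHull S)) {a : redAlg (leftInverseHull S)}
    (ha : a ∈ zeroSpan S) : b * a ∈ zeroSpan S := by
  induction ha using Submodule.span_induction with
  | mem x hx =>
    obtain ⟨z, hz, rfl⟩ := hx
    obtain ⟨c, hc⟩ := mul_regGen_zero S hz b
    rw [hc]
    exact Submodule.smul_mem _ _ (Submodule.subset_span ⟨z, hz, rfl⟩)
  | zero => rw [mul_zero]; exact zero_mem _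
  | add x y _ _ h1 h2 => rw [mul_add]; exact add_mem h1 h2
  | smul c x _ h => rw [mul_smul_comm]; exact Submodule.smul_mem _ _ h

/-- `Λ(ℂ 0)` as an ideal of `C*_r(I_l(S))`. -/
def zeroIdeal : Ideal (redAlg (leftInverseHull S)) where
  carrier := zeroSpan S
  add_mem' h1 h2 := add_mem h1 h2
  zero_mem' := zero_mem _
  smul_mem' b _ ha := mul_mem_zeroSpan S b ha

instance : (zeroIdeal S).IsTwoSided where
  mul_mem_of_left {a} b ha := by
    have h := star_mem_zeroSpan S (mul_mem_zeroSpan S (star b) (star_mem_zeroSpan S ha))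
    rw [star_mul, star_star, star_star] at h
    exact h

/-- `C*_{r,0}(I_l(S)) = C*_r(I_l(S)) / Λ(ℂ 0)`, with the quotient operations and quotient norm. -/
abbrev redAlgZero : Type _ := redAlg (leftInverseHull S) ⧸ zeroIdeal S

/-- The quotient norm `‖[a]‖ = inf {‖a + b‖ | b ∈ Λ(ℂ 0)}`. -/
instance : Norm (redAlgZero S) :=
  (Submodule.Quotient.seminormedAddCommGroup (zeroIdeal S)).toNorm

/-- The involution `[a]* = [a*]` of the quotient. -/
instance : Star (redAlgZero S) where
  star := Quotient.map' star (fun a b hab => by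
    rw [Submodule.quotientRel_def] at hab ⊢
    have h := star_mem_zeroSpan S (show a - b ∈ zeroSpan S from hab)
    rw [star_sub] at h
    exact h)

theorem star_mk (a : redAlg (leftInverseHull S)) :
    star (Ideal.Quotient.mk (zeroIdeal S) a) = Ideal.Quotient.mk (zeroIdeal S) (star a) := rfl

variable {S} in
/-- `Λ₀(f)`, the class of `Λ(f)` in `C*_{r,0}(I_l(S))`. -/
def regGenZero (f : leftInverseHull S) : redAlgZero S :=
  Ideal.Quotient.mk (zeroIdeal S) (regGen f)

variable {S} in
/-- The isometry `V_s ε_t = ε_{st}` of `ℓ²(S)`. -/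
def isom (s : S) : ell2 S →L[ℂ] ell2 S := op (ofInjective (fun t => s * t) (mul_right_injective s))

theorem isom_basisVec {S : Type*} [Monoid S] [IsLeftCancelMul S] (s t : S) :
    isom s (basisVec t) = basisVec (s * t) := op_basisVec _ t

/-- `C*_r(S)`, the C*-subalgebra of `B(ℓ²(S))` generated by the isometries `V_s`. -/
def toeplitzAlg : StarSubalgebra ℂ (ell2 S →L[ℂ] ell2 S) :=
  (StarAlgebra.adjoin ℂ (Set.range (isom (S := S)))).topologicalClosure

variable {S} in
/-- The representation `ω` of `I_l(S)` on `ℓ²(S)`: `ω(f) ε_s = ε_{f(s)}` if `s ∈ dom f`, and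
`ω(f) ε_s = 0` otherwise. -/
def omega (f : leftInverseHull S) : ell2 S →L[ℂ] ell2 S := op (show PEquiv S S from f.1)

theorem omega_lamHull {S : Type*} [Monoid S] [IsLeftCancelMul S] (s : S) :
    omega (lamHull s) = isom s := rfl

theorem lamHull_injective : Function.Injective (lamHull (S := S)) := by
  intro s t h
  have h1 : (lam s).app 1 = (lam t).app 1 := by
    rw [show lam s = lam t from congrArg Subtype.val h]
  have h2 : some (s * 1) = some (t * 1) := h1
  simpa using h2

/-- The isometry `T : ℓ²(S) → ℓ²(I_l(S))`, `T ε_s = δ_{λ_s}`. -/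
def intertwiner : ell2 S →L[ℂ] ell2 (leftInverseHull S) :=
  op (ofInjective lamHull (lamHull_injective S))

theorem intertwiner_basisVec (s : S) :
    intertwiner S (basisVec s) = basisVec (lamHull s) := op_basisVec _ s

/-- `I_l(S)` is `E*`-unitary: `f g = g` with `g ≠ 0` forces `f` to be idempotent. -/
def HullEStarUnitary : Prop :=
  ∀ f g : leftInverseHull S, f * g = g → ¬ IsZeroMap g → IsIdempotentElem f

end Hull

/-! ### Clifford's condition and constructible right ideals -/

section Ideals

variable (S : Type*) [Monoid S]

/-- Clifford's condition: for all `s`, `t`, either `sS ∩ tS = ∅` or `sS ∩ tS = rS` for some `r`. -/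
def CliffordCondition : Prop :=
  ∀ s t : S, Set.range (fun x => s * x) ∩ Set.range (fun x => t * x) = ∅ ∨
    ∃ r : S, Set.range (fun x => s * x) ∩ Set.range (fun x => t * x) = Set.range (fun x => r * x)

variable {S} in
/-- `t₁⁻¹ s₁ ⋯ tₙ⁻¹ sₙ S` for the list `[(t₁, s₁), …, (tₙ, sₙ)]`, where `sX = {s x | x ∈ X}` and
`t⁻¹ X = {x | t x ∈ X}`. -/
def wordIdeal : List (S × S) → Set S
  | [] => Set.univ
  | (t, s) :: w => (fun x => t * x) ⁻¹' ((fun x => s * x) '' wordIdeal w)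

/-- The family `J(S)` of constructible right ideals: the nonempty finite intersections of sets
`t₁⁻¹ s₁ ⋯ tₙ⁻¹ sₙ S` with `n ≥ 1`. -/
def constructibleIdeals : Set (Set S) :=
  {X | ∃ L : List (List (S × S)), L ≠ [] ∧ (∀ w ∈ L, w ≠ []) ∧ X = ⋂ w ∈ L, wordIdeal w}

/-- `J(S)` is independent: if a finite union of members (at least one) is a member `Y`, then one
of them equals `Y`. -/
def IndependentIdeals : Prop :=
  ∀ (n : ℕ) (Z : Fin (n + 1) → Set S) (Y : Set S), (∀ i, Z i ∈ constructibleIdeals S) →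
    Y ∈ constructibleIdeals S → (⋃ i, Z i) = Y → ∃ i, Z i = Y

end Ideals

end LeftHull

end

namespace LeftHull

/-! ### Elements of the left inverse hull -/

section HullElements

variable {S : Type*} [Monoid S] [IsLeftCancelMul S]

/-! Clifford's condition makes every nonempty element of the hull a fraction λ_p λ_q^*, namely qz ↦
pz (`eq_frac_of_clifford`), and every constructible ideal empty or principal
(`constructibleIdeal_eq`). If such a fraction has a fixed point pz = qz, right cancellation gives p
= q, whence (i). A principal ideal that is a union of right ideals equals the one containing its
generator, whence (ii).

For (iii), elements of the hull commute with right translations, so f λ_p λ_q^* = λ_{f(p)} λ_q^* for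
p in dom f (`mul_frac`). Hence for each q the column {λ_p λ_q^* : p ∈ S} carries a copy of the
representation ω on ℓ²(S) (`column_regRep`), and the column q = 1 is the range of T. One q per
principal right ideal gives disjoint columns that exhaust the nonzero elements. So a ∈ C*_r(I_l(S))
is a direct sum of copies of T* a T, together with a scalar on δ_0 if there is a zero. Each class
modulo ℂΛ(0) has a representative whose scalar vanishes (`exists_sub_mem_zeroSpan`), and on these
the compression is isometric (`norm_le_norm_compressHom`). -/

theorem lam_app {s x y : S} : (lam s).app x = some y ↔ s * x = y :=
  Option.some_inj

/-- The partial bijection `λ_p λ_q*`, sending `q * z` to `p * z`. -/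
noncomputable def frac (p q : S) : leftInverseHull S := lamHull p * star (lamHull q)

theorem frac_app {p q x y : S} :
    (frac p q).1.app x = some y ↔ ∃ z, q * z = x ∧ p * z = y := by
  change (lam p * star (lam q)).app x = some y ↔ _
  simp only [PartialBij.mul_app, PartialBij.star_app, lam_app]

theorem frac_app_self (p q : S) : (frac p q).1.app q = some p :=
  frac_app.2 ⟨1, mul_one q, mul_one p⟩

theorem hull_ext {f g : leftInverseHull S}
    (h : ∀ x y, f.1.app x = some y ↔ g.1.app x = some y) : f = g :=
  Subtype.ext (PartialBij.ext_iff_app.2 h)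

theorem hull_mul_app {f g : leftInverseHull S} {x z : S} :
    (f * g).1.app x = some z ↔ ∃ y, g.1.app x = some y ∧ f.1.app y = some z :=
  PartialBij.mul_app

theorem hull_star_app {f : leftInverseHull S} {x y : S} :
    (star f).1.app x = some y ↔ f.1.app y = some x :=
  PartialBij.star_app

theorem not_isZeroMap_iff {f : leftInverseHull S} :
    ¬ IsZeroMap f ↔ ∃ x y, f.1.app x = some y := by
  have hne : ∀ x y, (PartialBij.empty : PartialBij S).app x ≠ some y := fun x y => by
    rintro ⟨⟩
  rw [← not_iff_not, not_not, IsZeroMap, PartialBij.ext_iff_app]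
  simp [hne]

theorem frac_injective (q : S) : Function.Injective fun p : S => frac p q := by
  intro p p' h
  have h1 := frac_app_self p q
  rw [show frac p q = frac p' q from h, frac_app_self] at h1
  exact (Option.some.inj h1).symm

theorem frac_one (p : S) : frac p 1 = lamHull p :=
  hull_ext fun x y => by
    rw [frac_app]
    change _ ↔ (lam p).app x = some y
    simp [lam_app]

/-- Elements of the hull commute with right translations. -/
theorem app_mul_right {f : PartialBij S} (hf : f ∈ leftInverseHull S) {x y : S} (t : S)
    (h : f.app x = some y) : f.app (x * t) = some (y * t) := by
  induction hf using Submonoid.closure_induction generalizing x y with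
  | mem f hf =>
    rcases hf with ⟨s, rfl⟩ | ⟨_, ⟨s, rfl⟩, rfl⟩
    · rw [lam_app] at h ⊢
      rw [← mul_assoc, h]
    · rw [PartialBij.star_app, lam_app] at h ⊢
      rw [← mul_assoc, h]
  | one =>
    cases h
    rfl
  | mul f g _ _ hf hg =>
    obtain ⟨a, ha, hb⟩ := PartialBij.mul_app.1 h
    exact PartialBij.mul_app.2 ⟨a * t, hg ha, hf hb⟩

/-- Since f(p) = r forces f(pz) = rz for all z, left multiplication moves elements within a column.
Clifford's condition plays no role here. -/
theorem mul_frac {f : leftInverseHull S} {p r : S} (q : S) (h : f.1.app p = some r) :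
    f * frac p q = frac r q :=
  hull_ext fun x y => by
    rw [hull_mul_app]
    simp only [frac_app]
    constructor
    · rintro ⟨_, ⟨z, rfl, rfl⟩, hb⟩
      rw [app_mul_right f.2 z h] at hb
      exact ⟨z, rfl, Option.some.inj hb⟩
    · rintro ⟨z, rfl, rfl⟩
      exact ⟨p * z, ⟨z, rfl, rfl⟩, app_mul_right f.2 z h⟩

/-- Evaluate both sides at q. This matches the domain condition of the regular representation with
definedness of f^* at p. -/
theorem star_app_of_mul_star_mul_frac {f : leftInverseHull S} {p q : S}
    (h : f * star f * frac p q = frac p q) : ∃ r, (star f).1.app p = some r := by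
  have h1 := frac_app_self p q
  rw [← h, mul_assoc, hull_mul_app] at h1
  obtain ⟨a, ha, -⟩ := h1
  obtain ⟨b, hb, hb'⟩ := hull_mul_app.1 ha
  rw [frac_app_self] at hb
  obtain rfl := Option.some.inj hb
  exact ⟨a, hb'⟩

/-- Under Clifford's condition every element of the hull is empty or of the form `λ_p λ_q*`. -/
theorem eq_frac_of_clifford (hS : CliffordCondition S) {f : PartialBij S}
    (hf : f ∈ leftInverseHull S) :
    (∀ x y, f.app x ≠ some y) ∨
      ∃ p q : S, ∀ x y, f.app x = some y ↔ ∃ z, q * z = x ∧ p * z = y := by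
  induction hf using Submonoid.closure_induction with
  | mem f hf =>
    right
    rcases hf with ⟨s, rfl⟩ | ⟨_, ⟨s, rfl⟩, rfl⟩
    · exact ⟨s, 1, fun x y => by simp [lam_app]⟩
    · exact ⟨1, s, fun x y => by simp [PartialBij.star_app, lam_app]⟩
  | one =>
    refine Or.inr ⟨1, 1, fun x y => ?_⟩
    change some x = some y ↔ _
    simp
  | mul f g _ _ hf hg =>
    rcases hf with hf | ⟨p, q, hf⟩
    · left
      intro x y h
      obtain ⟨a, -, hb⟩ := PartialBij.mul_app.1 h
      exact hf _ _ hb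
    rcases hg with hg | ⟨p', q', hg⟩
    · left
      intro x y h
      obtain ⟨a, ha, -⟩ := PartialBij.mul_app.1 h
      exact hg _ _ ha
    -- The inner map has range p'S and the outer one has domain qS, so only p'S ∩ qS matters.
    rcases hS p' q with h0 | ⟨r, hr⟩
    · left
      intro x y h
      obtain ⟨a, ha, hb⟩ := PartialBij.mul_app.1 h
      obtain ⟨z, -, hz⟩ := (hg _ _).1 ha
      obtain ⟨w, hw, -⟩ := (hf _ _).1 hb
      exact (h0 ▸ (⟨⟨z, hz⟩, ⟨w, hw⟩⟩ :
        a ∈ Set.range (fun x => p' * x) ∩ Set.range (fun x => q * x)) : a ∈ (∅ : Set S))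
    · right
      -- Writing r = p'a = qb, the product sends q'av ↦ rv ↦ pbv.
      obtain ⟨⟨a, ha⟩, ⟨b, hb⟩⟩ := hr.ge (⟨1, mul_one r⟩ : r ∈ Set.range (fun x => r * x))
      simp only at ha hb
      refine ⟨p * b, q' * a, fun x y => ?_⟩
      rw [PartialBij.mul_app]
      constructor
      · rintro ⟨c, hc, hd⟩
        obtain ⟨z, rfl, hz⟩ := (hg _ _).1 hc
        obtain ⟨w, hw, rfl⟩ := (hf _ _).1 hd
        obtain ⟨v, hv⟩ := hr.le (⟨⟨z, hz⟩, ⟨w, hw⟩⟩ :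
          c ∈ Set.range (fun x => p' * x) ∩ Set.range (fun x => q * x))
        simp only at hv
        have hz' : z = a * v := mul_left_cancel (a := p') (by rw [hz, ← hv, ← ha, mul_assoc])
        have hw' : w = b * v := mul_left_cancel (a := q) (by rw [hw, ← hv, ← hb, mul_assoc])
        exact ⟨v, by rw [hz', mul_assoc], by rw [hw', mul_assoc]⟩
      · rintro ⟨v, rfl, rfl⟩
        refine ⟨r * v, (hg _ _).2 ⟨a * v, (mul_assoc _ _ _).symm, ?_⟩,
          (hf _ _).2 ⟨b * v, ?_, (mul_assoc _ _ _).symm⟩⟩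
        · rw [← ha, mul_assoc]
        · rw [← hb, mul_assoc]

theorem exists_eq_frac (hS : CliffordCondition S) {f : leftInverseHull S} (hf : ¬ IsZeroMap f) :
    ∃ p q, f = frac p q := by
  obtain ⟨x, y, hxy⟩ := not_isZeroMap_iff.1 hf
  rcases eq_frac_of_clifford hS f.2 with h | ⟨p, q, h⟩
  · exact absurd hxy (h x y)
  · exact ⟨p, q, hull_ext fun x y => by rw [h, frac_app]⟩

end HullElements

/-- Any y in the range of g is a fixed point of f, and a fraction with a fixed point is λ_p λ_p^*.
-/
theorem hullEStarUnitary_of_clifford {S : Type*} [Monoid S] [IsCancelMul S]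
    (hS : CliffordCondition S) : HullEStarUnitary S := by
  intro f g hfg hg
  obtain ⟨x, y, hxy⟩ := not_isZeroMap_iff.1 hg
  have h1 := hxy
  rw [← hfg] at h1
  obtain ⟨a, ha, hy⟩ := hull_mul_app.1 h1
  rw [hxy] at ha
  obtain rfl := Option.some.inj ha
  obtain ⟨p, q, rfl⟩ := exists_eq_frac hS (not_isZeroMap_iff.2 ⟨y, y, hy⟩)
  obtain ⟨z, hz, hz'⟩ := frac_app.1 hy
  obtain rfl : p = q := mul_right_cancel (hz'.trans hz.symm)
  exact mul_frac p (frac_app_self p p)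

/-! ### Constructible right ideals -/

section Ideals

variable {S : Type*} [Monoid S]

/-- The inductive step is t⁻¹(srS) = {x : tx ∈ tS ∩ srS}. If the intersection is cS with c = td,
left cancellation of t leaves dS. -/
theorem wordIdeal_eq (hS : CliffordCondition S) [IsLeftCancelMul S] (w : List (S × S)) :
    wordIdeal w = ∅ ∨ ∃ r : S, wordIdeal w = Set.range fun x => r * x := by
  induction w with
  | nil => exact Or.inr ⟨1, by simp [wordIdeal]⟩
  | cons a w ih =>
    obtain ⟨t, s⟩ := a
    rcases ih with h | ⟨r, h⟩
    · exact Or.inl (by simp [wordIdeal, h])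
    have hmem : ∀ x, x ∈ wordIdeal ((t, s) :: w) ↔
        t * x ∈ Set.range (fun x => t * x) ∩ Set.range (fun x => s * r * x) := by
      intro x
      simp [wordIdeal, h, mul_assoc]
    rcases hS t (s * r) with h0 | ⟨c, hc⟩
    · left
      ext x
      rw [hmem, h0]
      simp
    · right
      obtain ⟨⟨d, hd⟩, -⟩ := hc.ge (⟨1, mul_one c⟩ : c ∈ Set.range (fun x => c * x))
      refine ⟨d, Set.ext fun x => ?_⟩
      rw [hmem, hc, ← hd]
      simp [mul_assoc]

theorem constructibleIdeal_eq (hS : CliffordCondition S) [IsLeftCancelMul S] {X : Set S}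
    (hX : X ∈ constructibleIdeals S) : X = ∅ ∨ ∃ r : S, X = Set.range fun x => r * x := by
  obtain ⟨L, -, -, rfl⟩ := hX
  induction L with
  -- The empty intersection is all of S, so the induction can start here even though constructible
  -- ideals use nonempty lists.
  | nil => exact Or.inr ⟨1, by simp⟩
  | cons w L ih =>
    have hL : (⋂ v ∈ w :: L, wordIdeal v) = wordIdeal w ∩ ⋂ v ∈ L, wordIdeal v := by
      ext x
      simp
    rw [hL]
    rcases wordIdeal_eq hS w with h | ⟨r, h⟩
    · exact Or.inl (by rw [h, Set.empty_inter])
    rcases ih with h' | ⟨r', h'⟩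
    · exact Or.inl (by rw [h', Set.inter_empty])
    · rw [h, h']
      exact hS r r'

theorem independentIdeals_of_clifford (hS : CliffordCondition S) [IsLeftCancelMul S] :
    IndependentIdeals S := by
  intro n Z Y hZ hY hU
  have hsub : ∀ i, Z i ⊆ Y := fun i => hU ▸ Set.subset_iUnion Z i
  rcases constructibleIdeal_eq hS hY with rfl | ⟨r, rfl⟩
  -- The family is indexed by `Fin (n + 1)`, so a member exists.
  · exact ⟨0, Set.subset_empty_iff.1 (hsub 0)⟩
  · obtain ⟨i, hi⟩ := Set.mem_iUnion.1 (hU.ge (⟨1, mul_one r⟩ : r ∈ Set.range (fun x => r * x)))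
    refine ⟨i, (hsub i).antisymm ?_⟩
    rcases constructibleIdeal_eq hS (hZ i) with h | ⟨c, h⟩
    · rw [h] at hi
      exact hi.elim
    · rw [h] at hi ⊢
      obtain ⟨d, rfl⟩ := hi
      rintro _ ⟨x, rfl⟩
      exact ⟨d * x, (mul_assoc _ _ _).symm⟩

end Ideals

/-! ### A transversal of the principal right ideals -/

section Transversal

variable {S : Type*} [Monoid S]

/-- A chosen generator of the principal right ideal `qS`. -/
noncomputable def generator (q : S) : S :=
  Classical.epsilon fun r : S => (Set.range fun x => r * x) = Set.range fun x => q * x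

theorem range_generator (q : S) :
    (Set.range fun x => generator q * x) = Set.range fun x => q * x :=
  Classical.epsilon_spec (p := fun r : S => (Set.range fun x => r * x) = Set.range fun x => q * x)
    ⟨q, rfl⟩

/-- The choice depends only on the ideal, so a chosen generator is its own chosen generator. -/
theorem generator_congr {q r : S}
    (h : (Set.range fun x => q * x) = Set.range fun x => r * x) : generator q = generator r := by
  unfold generator
  rw [h]

variable (S) in
/-- The chosen generators of the principal right ideals. -/
def Generators : Type _ := {q : S // generator q = q}

variable [IsLeftCancelMul S]

/-- The two generators of qS differ by a unit u, and λ_p λ_q^* = λ_{pu} λ_{qu}^*. -/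
theorem frac_generator (p q : S) : ∃ r, frac p q = frac r (generator q) := by
  obtain ⟨u, hu⟩ : generator q ∈ Set.range fun x => q * x :=
    range_generator q ▸ ⟨1, mul_one _⟩
  obtain ⟨v, hv⟩ : q ∈ Set.range fun x => generator q * x :=
    (range_generator q).symm ▸ ⟨1, mul_one _⟩
  simp only at hu hv
  have huv : u * v = 1 := mul_left_cancel (a := q) (by rw [← mul_assoc, hu, hv, mul_one])
  refine ⟨p * u, hull_ext fun x y => ?_⟩
  simp only [frac_app]
  constructor
  · rintro ⟨z, rfl, rfl⟩
    exact ⟨v * z, by rw [← mul_assoc, hv], by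
      rw [mul_assoc, ← mul_assoc u, huv, one_mul]⟩
  · rintro ⟨z, rfl, rfl⟩
    exact ⟨u * z, by rw [← mul_assoc, hu], (mul_assoc _ _ _).symm⟩

/-- The domain qS determines q among the chosen generators, and then the value at q determines p.
This makes distinct columns disjoint. -/
theorem frac_generators_injective :
    Function.Injective fun i : Generators S × S => frac i.2 i.1.1 := by
  rintro ⟨⟨q, hq⟩, p⟩ ⟨⟨q', hq'⟩, p'⟩ h
  have h : frac p q = frac p' q' := h
  have hdom : ∀ p q x : S, (x ∈ Set.range fun z => q * z) ↔ ∃ y, (frac p q).1.app x = some y := by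
    intro p q x
    simp only [frac_app]
    exact ⟨fun ⟨z, hz⟩ => ⟨_, z, hz, rfl⟩, fun ⟨_, z, hz, _⟩ => ⟨z, hz⟩⟩
  have hqq : q = q' := by
    rw [← hq, ← hq']
    exact generator_congr (Set.ext fun x => by rw [hdom p, hdom p', h])
  subst hqq
  have hpp := frac_injective q h
  subst hpp
  rfl

theorem exists_generators_frac (hS : CliffordCondition S) {f : leftInverseHull S}
    (hf : ¬ IsZeroMap f) : ∃ i : Generators S × S, frac i.2 i.1.1 = f := by
  obtain ⟨p, q, rfl⟩ := exists_eq_frac hS hf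
  obtain ⟨r, hr⟩ := frac_generator p q
  exact ⟨(⟨generator q, generator_congr (range_generator q)⟩, r), hr.symm⟩

end Transversal

/-! ### Coordinates and norms in `ℓ²` -/

section Ell2

variable {X Y : Type*}

theorem inner_basisVec (x : X) (ξ : ell2 X) : inner ℂ (basisVec x) ξ = ξ x := by
  classical
  have h := lp.inner_single_left (𝕜 := ℂ) (G := fun _ : X => ℂ) x (1 : ℂ) ξ
  simpa [basisVec] using h

theorem adjoint_op_ofInjective_apply (g : X → Y) (hg : Function.Injective g) (η : ell2 Y) (x : X) :
    (op (ofInjective g hg)).adjoint η x = η (g x) := by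
  rw [← inner_basisVec, ContinuousLinearMap.adjoint_inner_right, op_basisVec]
  exact inner_basisVec (g x) η

theorem hasSum_norm_sq (ξ : ell2 X) : HasSum (fun x => ‖ξ x‖ ^ 2) (‖ξ‖ ^ 2) := by
  have h := lp.hasSum_norm (p := 2) (by norm_num) ξ
  simpa using h

end Ell2

/-! ### Restriction of the regular representation to the columns `λ_p λ_q*` -/

section Regular

variable {S : Type*} [Monoid S] [IsLeftCancelMul S]

/-- The adjoint of the isometry `ε_p ↦ δ_{λ_p λ_q*}`. -/
noncomputable def column (q : S) : ell2 (leftInverseHull S) →L[ℂ] ell2 S :=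
  (op (ofInjective (fun p => frac p q) (frac_injective q))).adjoint

theorem column_apply (q p : S) (ξ : ell2 (leftInverseHull S)) : column q ξ p = ξ (frac p q) :=
  adjoint_op_ofInjective_apply _ _ ξ p

theorem adjoint_intertwiner_apply (ξ : ell2 (leftInverseHull S)) (p : S) :
    (intertwiner S).adjoint ξ p = ξ (lamHull p) :=
  adjoint_op_ofInjective_apply _ _ ξ p

/-- Because λ_p λ_1^* = λ_p, compressing by T is looking at one particular column. -/
theorem column_one : column (1 : S) = (intertwiner S).adjoint := by
  refine ContinuousLinearMap.ext fun ξ => lp.ext (funext fun p => ?_)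
  rw [column_apply, adjoint_intertwiner_apply, frac_one]

theorem omega_apply (f : leftInverseHull S) (ξ : ell2 S) (p : S) :
    omega f ξ p = ((star f).1.app p).elim 0 ξ := rfl

/-- At coordinate p both sides read ξ at λ_r λ_q^* with r = f^*(p), and both vanish if f^* is
undefined at p. -/
theorem column_regRep (q : S) (f : leftInverseHull S) (ξ : ell2 (leftInverseHull S)) :
    column q (regRep f ξ) = omega f (column q ξ) := by
  classical
  refine lp.ext (funext fun p => ?_)
  rw [column_apply, regRep_apply, omega_apply]
  split_ifs with h
  · obtain ⟨r, hr⟩ := star_app_of_mul_star_mul_frac h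
    rw [hr, mul_frac q hr, Option.elim_some, column_apply]
  · rcases hr : (star f).1.app p with _ | r
    · rfl
    · refine absurd ?_ h
      rw [mul_assoc, mul_frac q hr, mul_frac q (hull_star_app.1 hr)]

/-! ### Compression by T, and its multiplicativity on C*_r(I_l(S)) -/

variable (S) in
theorem adjoint_intertwiner_comp :
    (intertwiner S).adjoint ∘L intertwiner S = ContinuousLinearMap.id ℂ _ := by
  refine ContinuousLinearMap.ext fun ξ => lp.ext (funext fun p => ?_)
  change (intertwiner S).adjoint (intertwiner S ξ) p = ξ p
  rw [adjoint_intertwiner_apply, intertwiner, op_apply]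
  have h : (ofInjective lamHull (lamHull_injective S)).symm (lamHull p) = some p :=
    (PEquiv.eq_some_iff _).2 rfl
  rw [h, Option.elim_some]

/-- The compression `a ↦ T* a T`. -/
noncomputable def compress :
    (ell2 (leftInverseHull S) →L[ℂ] ell2 (leftInverseHull S)) →L[ℂ] (ell2 S →L[ℂ] ell2 S) :=
  (ContinuousLinearMap.compL ℂ _ _ _ (intertwiner S).adjoint) ∘L
    ((ContinuousLinearMap.compL ℂ _ _ _).flip (intertwiner S))

theorem compress_apply (a : ell2 (leftInverseHull S) →L[ℂ] ell2 (leftInverseHull S)) :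
    compress a = (intertwiner S).adjoint ∘L a ∘L intertwiner S := rfl

theorem compress_one :
    compress (1 : ell2 (leftInverseHull S) →L[ℂ] ell2 (leftInverseHull S)) = 1 :=
  adjoint_intertwiner_comp S

theorem compress_star (a : ell2 (leftInverseHull S) →L[ℂ] ell2 (leftInverseHull S)) :
    compress (star a) = star (compress a) := by
  simp only [compress_apply, ContinuousLinearMap.star_eq_adjoint, ContinuousLinearMap.adjoint_comp,
    ContinuousLinearMap.adjoint_adjoint, ContinuousLinearMap.comp_assoc]

theorem compress_regRep (f : leftInverseHull S) : compress (regRep f) = omega f := by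
  refine ContinuousLinearMap.ext fun ξ => ?_
  change (intertwiner S).adjoint (regRep f (intertwiner S ξ)) = _
  rw [← column_one, column_regRep, column_one]
  exact congrArg _ (DFunLike.congr_fun (adjoint_intertwiner_comp S) ξ)

theorem omega_one : omega (1 : leftInverseHull S) = 1 := by
  refine ContinuousLinearMap.ext fun ξ => lp.ext (funext fun p => ?_)
  rfl

theorem omega_mul (f g : leftInverseHull S) : omega (f * g) = omega f * omega g := by
  refine ContinuousLinearMap.ext fun ξ => lp.ext (funext fun p => ?_)
  change ((star (f * g)).1.app p).elim 0 ξ = ((star f).1.app p).elim 0 (omega g ξ)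
  have h : star (f * g) = star g * star f := Subtype.ext (PartialBij.star_mul' f.1 g.1)
  rw [h]
  change (((star f).1.app p).bind (star g).1.app).elim 0 ξ = _
  rcases (star f).1.app p with _ | r
  · rfl
  · rw [Option.elim_some, omega_apply]
    rfl

/-- By multiplicativity only λ_s and its inverse need checking; they give V_s and V_s^*. -/
theorem omega_mem (f : leftInverseHull S) : omega f ∈ toeplitzAlg S := by
  obtain ⟨f, hf⟩ := f
  induction hf using Submonoid.closure_induction with
  | mem f hf =>
    have hisom : ∀ s : S, isom s ∈ toeplitzAlg S := fun s =>
      StarSubalgebra.le_topologicalClosure _ (StarAlgebra.subset_adjoin ℂ _ ⟨s, rfl⟩)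
    rcases hf with ⟨s, rfl⟩ | ⟨_, ⟨s, rfl⟩, rfl⟩
    · exact hisom s
    · have h := star_mem (hisom s)
      rw [isom, star_op] at h
      exact h
  | one =>
    rw [show (⟨1, _⟩ : leftInverseHull S) = 1 from rfl, omega_one]
    exact one_mem _
  | mul f g hf hg h1 h2 =>
    have h := mul_mem h1 h2
    rw [← omega_mul] at h
    exact h

variable (S) in
/-- The operators whose columns are all governed by their compression, which lies in `C*_r(S)`. -/
noncomputable def columnSubalgebra :
    Subalgebra ℂ (ell2 (leftInverseHull S) →L[ℂ] ell2 (leftInverseHull S)) where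
  carrier := {a | (∀ q ξ, column q (a ξ) = compress a (column q ξ)) ∧ compress a ∈ toeplitzAlg S}
  mul_mem' := by
    rintro a b ⟨ha, ha'⟩ ⟨hb, hb'⟩
    -- The column condition at q = 1 says T* a = (T* a T) T*, which makes the compression
    -- multiplicative.
    have h : compress (a * b) = compress a * compress b := by
      refine ContinuousLinearMap.ext fun ξ => ?_
      change (intertwiner S).adjoint (a (b (intertwiner S ξ))) =
        compress a ((intertwiner S).adjoint (b (intertwiner S ξ)))
      rw [← column_one, ha]
    rw [Set.mem_ofPred_eq, h]
    refine ⟨fun q ξ => ?_, mul_mem ha' hb'⟩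
    change column q (a (b ξ)) = compress a (compress b _)
    rw [ha, hb]
  add_mem' := by
    rintro a b ⟨ha, ha'⟩ ⟨hb, hb'⟩
    rw [Set.mem_ofPred_eq, map_add]
    refine ⟨fun q ξ => ?_, add_mem ha' hb'⟩
    simp only [add_apply, map_add, ha, hb]
  algebraMap_mem' c := by
    rw [Set.mem_ofPred_eq, Algebra.algebraMap_eq_smul_one, map_smul, compress_one,
      ← Algebra.algebraMap_eq_smul_one c]
    refine ⟨fun q ξ => ?_, algebraMap_mem _ c⟩
    rw [Algebra.algebraMap_eq_smul_one]
    exact map_smul (column q) c ξ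

/-- The defining conditions are closed in a and hold for each Λ(f). The generators are stable under
the involution, so a plain subalgebra suffices. -/
theorem redAlg_le_columnSubalgebra
    {a : ell2 (leftInverseHull S) →L[ℂ] ell2 (leftInverseHull S)}
    (ha : a ∈ redAlg (leftInverseHull S)) : a ∈ columnSubalgebra S := by
  let R : Set (ell2 (leftInverseHull S) →L[ℂ] ell2 (leftInverseHull S)) :=
    Set.range (regRep (P := leftInverseHull S))
  have hstar : star R ⊆ R := by
    rintro x ⟨p, hp⟩
    exact ⟨star p, by rw [← star_regRep, hp, star_star]⟩
  have hcl : IsClosed (columnSubalgebra S :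
      Set (ell2 (leftInverseHull S) →L[ℂ] ell2 (leftInverseHull S))) := by
    have h : (columnSubalgebra S :
        Set (ell2 (leftInverseHull S) →L[ℂ] ell2 (leftInverseHull S))) =
        (⋂ q, ⋂ ξ, {a | column q (a ξ) = compress a (column q ξ)}) ∩
          compress ⁻¹' (toeplitzAlg S) := by
      ext a
      simp only [Set.mem_inter_iff, Set.mem_iInter]
      rfl
    rw [h]
    refine IsClosed.inter ?_ ((StarSubalgebra.isClosed_topologicalClosure _).preimage
      (compress (S := S)).continuous)
    refine isClosed_iInter fun q => isClosed_iInter fun ξ => isClosed_eq ?_ ?_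
    · exact (column q).continuous.comp (ContinuousLinearMap.apply ℂ _ ξ).continuous
    · exact (ContinuousLinearMap.apply ℂ _ (column q ξ)).continuous.comp
        (compress (S := S)).continuous
  refine closure_minimal (fun b hb => ?_) hcl ha
  have h3 : b ∈ (StarAlgebra.adjoin ℂ R).toSubalgebra := hb
  rw [StarAlgebra.adjoin_toSubalgebra, Set.union_eq_left.2 hstar] at h3
  refine Algebra.adjoin_le ?_ h3
  rintro _ ⟨f, rfl⟩
  refine ⟨fun q ξ => ?_, ?_⟩
  · rw [compress_regRep, column_regRep]
  · rw [compress_regRep]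
    exact omega_mem f

variable (S) in
/-- The `*`-homomorphism `a ↦ T* a T` on `C*_r(I_l(S))`. -/
noncomputable def compressHom : redAlg (leftInverseHull S) →⋆ₐ[ℂ] (ell2 S →L[ℂ] ell2 S) where
  toFun a := compress a.1
  map_one' := compress_one
  map_mul' a b := by
    refine ContinuousLinearMap.ext fun ξ => ?_
    change (intertwiner S).adjoint (a.1 (b.1 (intertwiner S ξ))) =
      compress a.1 ((intertwiner S).adjoint (b.1 (intertwiner S ξ)))
    rw [← column_one, (redAlg_le_columnSubalgebra a.2).1]
  map_zero' := map_zero _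
  map_add' a b := map_add _ _ _
  commutes' c := by
    change compress (algebraMap ℂ _ c) = _
    rw [Algebra.algebraMap_eq_smul_one, map_smul, compress_one, ← Algebra.algebraMap_eq_smul_one]
  map_star' a := compress_star a.1

theorem compressHom_mem (a : redAlg (leftInverseHull S)) : compressHom S a ∈ toeplitzAlg S :=
  (redAlg_le_columnSubalgebra a.2).2

theorem norm_intertwiner_le : ‖intertwiner S‖ ≤ 1 := by
  unfold intertwiner op
  exact LinearMap.mkContinuous_norm_le _ zero_le_one _

theorem norm_compressHom_le (a : redAlg (leftInverseHull S)) : ‖compressHom S a‖ ≤ ‖a‖ := by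
  have h1 : ‖(intertwiner S).adjoint‖ ≤ 1 := by
    rw [LinearIsometryEquiv.norm_map]
    exact norm_intertwiner_le
  calc ‖compressHom S a‖
      ≤ ‖(intertwiner S).adjoint‖ * (‖a.1‖ * ‖intertwiner S‖) :=
        (ContinuousLinearMap.opNorm_comp_le _ _).trans
          (mul_le_mul_of_nonneg_left (ContinuousLinearMap.opNorm_comp_le _ _) (norm_nonneg _))
    _ ≤ 1 * (‖a.1‖ * 1) := by
        gcongr
        exact norm_intertwiner_le
    _ = ‖a‖ := by rw [one_mul, mul_one]; rfl

/-! ### The part of the regular representation orthogonal to the zero -/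

variable (S) in
/-- The vectors of `ℓ²(I_l(S))` that vanish at the zero of `I_l(S)`. -/
def nonzeroVectors : Submodule ℂ (ell2 (leftInverseHull S)) where
  carrier := {ξ | ∀ z : leftInverseHull S, IsZeroMap z → ξ z = 0}
  add_mem' h1 h2 z hz := by
    rw [lp.coeFn_add, Pi.add_apply, h1 z hz, h2 z hz, add_zero]
  zero_mem' _ _ := rfl
  smul_mem' c ξ h z hz := by
    rw [lp.coeFn_smul, Pi.smul_apply, h z hz, smul_zero]

theorem summable_norm_frac_sq (ξ : ell2 (leftInverseHull S)) :
    Summable fun i : Generators S × S => ‖ξ (frac i.2 i.1.1)‖ ^ 2 :=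
  (hasSum_norm_sq ξ).summable.comp_injective frac_generators_injective

theorem tsum_norm_frac_sq (ξ : ell2 (leftInverseHull S)) :
    ∑' i : Generators S × S, ‖ξ (frac i.2 i.1.1)‖ ^ 2 =
      ∑' q : Generators S, ‖column q.1 ξ‖ ^ 2 := by
  rw [(summable_norm_frac_sq ξ).tsum_prod]
  refine tsum_congr fun q => ?_
  rw [← (hasSum_norm_sq (column q.1 ξ)).tsum_eq]
  simp only [column_apply]

theorem summable_norm_column_sq (ξ : ell2 (leftInverseHull S)) :
    Summable fun q : Generators S => ‖column q.1 ξ‖ ^ 2 := by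
  refine (summable_norm_frac_sq ξ).prod.congr fun q => ?_
  rw [← (hasSum_norm_sq (column q.1 ξ)).tsum_eq]
  simp only [column_apply]

/-- Bessel's inequality for the disjoint columns. -/
theorem tsum_norm_column_sq_le (ξ : ell2 (leftInverseHull S)) :
    ∑' q : Generators S, ‖column q.1 ξ‖ ^ 2 ≤ ‖ξ‖ ^ 2 := by
  rw [← tsum_norm_frac_sq, ← (hasSum_norm_sq ξ).tsum_eq]
  exact (summable_norm_frac_sq ξ).tsum_le_tsum_of_inj _ frac_generators_injective
    (fun _ _ => sq_nonneg _) (fun _ => le_rfl) (hasSum_norm_sq ξ).summable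

/-- Here Clifford's condition enters: the columns miss only the zero, where ξ vanishes, so Bessel
becomes Parseval. -/
theorem norm_sq_eq_tsum_column (hS : CliffordCondition S) {ξ : ell2 (leftInverseHull S)}
    (hξ : ξ ∈ nonzeroVectors S) : ‖ξ‖ ^ 2 = ∑' q : Generators S, ‖column q.1 ξ‖ ^ 2 := by
  rw [← tsum_norm_frac_sq, ← (hasSum_norm_sq ξ).tsum_eq]
  refine (frac_generators_injective.tsum_eq (f := fun f => ‖ξ f‖ ^ 2) fun f hf => ?_).symm
  refine exists_generators_frac hS fun hz => hf ?_
  simp [hξ f hz]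

/-- On every column b acts as T* b T. Parseval applies to bξ, while Bessel is enough for ξ, which
may have a component along δ_0. -/
theorem norm_le_norm_compressHom (hS : CliffordCondition S) (b : redAlg (leftInverseHull S))
    (hb : ∀ ξ, b.1 ξ ∈ nonzeroVectors S) : ‖b‖ ≤ ‖compressHom S b‖ := by
  refine ContinuousLinearMap.opNorm_le_bound b.1 (norm_nonneg _) fun ξ => ?_
  refine le_of_sq_le_sq ?_ (by positivity)
  rw [norm_sq_eq_tsum_column hS (hb ξ), mul_pow]
  calc ∑' q : Generators S, ‖column q.1 (b.1 ξ)‖ ^ 2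
      ≤ ∑' q : Generators S, ‖compressHom S b‖ ^ 2 * ‖column q.1 ξ‖ ^ 2 := by
        refine (summable_norm_column_sq (b.1 ξ)).tsum_le_tsum (fun q => ?_)
          ((summable_norm_column_sq ξ).mul_left _)
        rw [(redAlg_le_columnSubalgebra b.2).1, ← mul_pow]
        exact pow_le_pow_left₀ (norm_nonneg _) (ContinuousLinearMap.le_opNorm _ _) 2
    _ = ‖compressHom S b‖ ^ 2 * ∑' q : Generators S, ‖column q.1 ξ‖ ^ 2 := tsum_mul_left
    _ ≤ ‖compressHom S b‖ ^ 2 * ‖ξ‖ ^ 2 :=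
        mul_le_mul_of_nonneg_left (tsum_norm_column_sq_le ξ) (sq_nonneg _)

variable (S) in
/-- The elements of `C*_r(I_l(S))` whose range is orthogonal to the zero of `I_l(S)`. -/
noncomputable def nonzeroPart : Submodule ℂ (redAlg (leftInverseHull S)) where
  carrier := {b | ∀ ξ, b.1 ξ ∈ nonzeroVectors S}
  add_mem' h1 h2 ξ := add_mem (h1 ξ) (h2 ξ)
  zero_mem' _ := zero_mem (nonzeroVectors S)
  smul_mem' c _ h ξ := (nonzeroVectors S).smul_mem c (h ξ)

/-- The zero is the empty map, so ω kills it; hence h is well defined. -/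
theorem compressHom_eq_zero {a : redAlg (leftInverseHull S)} (ha : a ∈ zeroSpan S) :
    compressHom S a = 0 := by
  induction ha using Submodule.span_induction with
  | mem x hx =>
    obtain ⟨z, hz, rfl⟩ := hx
    change compress (regRep z) = 0
    rw [compress_regRep]
    refine ContinuousLinearMap.ext fun ξ => lp.ext (funext fun p => ?_)
    rw [omega_apply, hz.star, show z.1 = PartialBij.empty from hz]
    rfl
  | zero => exact map_zero _
  | add x y _ _ h1 h2 => rw [map_add, h1, h2, add_zero]
  | smul c x _ h => rw [map_smul, h, smul_zero]

/-- If there is a zero, δ_0 is an eigenvector of a^*, with eigenvalue c say. Then aξ has coordinate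
c̄ ξ(0) at 0, and since Λ(0) projects onto δ_0, subtracting c̄ Λ(0) removes it. -/
theorem exists_sub_mem_zeroSpan (a : redAlg (leftInverseHull S)) :
    ∃ b ∈ nonzeroPart S, a - b ∈ zeroSpan S := by
  by_cases hz : ∃ z : leftInverseHull S, IsZeroMap z
  · obtain ⟨z, hz⟩ := hz
    obtain ⟨c, hc⟩ := mem_adjoin_zero S hz (star_mem a.2)
    have hc' : ∀ ξ, a.1 ξ z = (starRingEnd ℂ) c * ξ z := by
      intro ξ
      rw [← inner_basisVec, ← ContinuousLinearMap.adjoint_inner_left,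
        ← ContinuousLinearMap.star_eq_adjoint, hc, inner_smul_left, inner_basisVec]
    refine ⟨a - (starRingEnd ℂ) c • regGen z, fun ξ z' hz' => ?_, ?_⟩
    · obtain rfl : z' = z := Subtype.ext (hz'.trans hz.symm)
      change a.1 ξ z' - (starRingEnd ℂ) c * regRep z' ξ z' = 0
      rw [hc', regRep_zero S hz]
      simp [basisVec]
    · rw [sub_sub_cancel]
      exact Submodule.smul_mem _ _ (Submodule.subset_span ⟨z, hz, rfl⟩)
  · refine ⟨a, fun ξ z h => (hz ⟨z, h⟩).elim, ?_⟩
    rw [sub_self]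
    exact zero_mem _

theorem mem_zeroSpan_iff (hS : CliffordCondition S) (a : redAlg (leftInverseHull S)) :
    a ∈ zeroSpan S ↔ compressHom S a = 0 := by
  refine ⟨compressHom_eq_zero, fun h => ?_⟩
  obtain ⟨b, hb, hab⟩ := exists_sub_mem_zeroSpan a
  have h1 := compressHom_eq_zero hab
  rw [map_sub, h, zero_sub, neg_eq_zero] at h1
  have h2 := norm_le_norm_compressHom hS b hb
  rw [h1, norm_zero] at h2
  rwa [norm_le_zero_iff.1 h2, sub_zero] at hab

/-- Supplies the completeness behind the closed range in `range_compressHom`. -/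
theorem isClosed_nonzeroPart : IsClosed (nonzeroPart S : Set (redAlg (leftInverseHull S))) := by
  have h : (nonzeroPart S : Set (redAlg (leftInverseHull S))) =
      ⋂ ξ, ⋂ z, ⋂ (_ : IsZeroMap z), {b | inner ℂ (basisVec z) (b.1 ξ) = 0} := by
    ext b
    simp only [Set.mem_iInter, Set.mem_ofPred_eq, inner_basisVec]
    rfl
  rw [h]
  refine isClosed_iInter fun ξ => isClosed_iInter fun z => isClosed_iInter fun _ =>
    isClosed_eq ?_ continuous_const
  exact (innerSL ℂ (basisVec z)).continuous.comp
    ((ContinuousLinearMap.apply ℂ _ ξ).continuous.comp continuous_subtype_val)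

theorem norm_compressHom_eq (hS : CliffordCondition S) {b : redAlg (leftInverseHull S)}
    (hb : b ∈ nonzeroPart S) : ‖compressHom S b‖ = ‖b‖ :=
  (norm_compressHom_le b).antisymm (norm_le_norm_compressHom hS b hb)

theorem isometry_compressHom_nonzeroPart (hS : CliffordCondition S) :
    Isometry fun b : nonzeroPart S => compressHom S b.1 :=
  Isometry.of_dist_eq fun b c => by
    calc dist (compressHom S b.1) (compressHom S c.1)
        = ‖compressHom S (b.1 - c.1)‖ := by
          rw [dist_eq_norm]
          exact congrArg norm (map_sub (compressHom S) b.1 c.1).symm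
      _ = ‖b.1 - c.1‖ := norm_compressHom_eq hS (Submodule.sub_mem _ b.2 c.2)
      _ = dist b c := (dist_eq_norm b.1 c.1).symm

/-- The range is already the image of `nonzeroPart`, a complete space mapped isometrically, so it is
closed; it contains every V_s. -/
theorem range_compressHom (hS : CliffordCondition S) :
    (compressHom S).range = toeplitzAlg S := by
  have himage : ((compressHom S).range : Set _) = compressHom S '' nonzeroPart S := by
    refine Set.Subset.antisymm ?_ ?_
    · rintro _ ⟨a, rfl⟩
      obtain ⟨b, hb, hab⟩ := exists_sub_mem_zeroSpan a
      refine ⟨b, hb, ?_⟩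
      have h1 := compressHom_eq_zero hab
      rw [map_sub, sub_eq_zero] at h1
      exact h1.symm
    · rintro _ ⟨a, -, rfl⟩
      exact ⟨a, rfl⟩
  have hclosed : IsClosed ((compressHom S).range : Set (ell2 S →L[ℂ] ell2 S)) := by
    rw [himage]
    have : CompleteSpace (redAlg (leftInverseHull S)) :=
      (StarSubalgebra.isClosed_topologicalClosure _).completeSpace_coe
    have : CompleteSpace (nonzeroPart S) := isClosed_nonzeroPart.completeSpace_coe
    have h := (isometry_compressHom_nonzeroPart hS).isClosedEmbedding.isClosed_range
    rwa [Set.range_comp' (compressHom S) Subtype.val, Subtype.range_coe] at h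
  refine le_antisymm ?_ ?_
  · rintro _ ⟨a, rfl⟩
    exact compressHom_mem a
  · refine StarSubalgebra.topologicalClosure_minimal (StarAlgebra.adjoin_le ?_) hclosed
    rintro _ ⟨s, rfl⟩
    exact ⟨regGen (lamHull s), compress_regRep (lamHull s)⟩

/-! ### The isomorphism -/

variable (S) in
/-- The map `[a] ↦ T* a T` from `C*_{r,0}(I_l(S))` to `C*_r(S)`. -/
noncomputable def quotientHom : redAlgZero S →+* toeplitzAlg S :=
  Ideal.Quotient.lift (zeroIdeal S)
    ((compressHom S).codRestrict (toeplitzAlg S) compressHom_mem).toRingHom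
    fun _ ha => Subtype.ext (compressHom_eq_zero ha)

theorem quotientHom_bijective (hS : CliffordCondition S) :
    Function.Bijective (quotientHom S) := by
  constructor
  · intro x y hxy
    obtain ⟨a, rfl⟩ := Ideal.Quotient.mk_surjective x
    obtain ⟨b, rfl⟩ := Ideal.Quotient.mk_surjective y
    have hab : compressHom S a = compressHom S b := congrArg Subtype.val hxy
    refine Ideal.Quotient.eq.2 ((mem_zeroSpan_iff hS (a - b)).2 ?_)
    rw [map_sub, hab, sub_self]
  · rintro ⟨y, hy⟩
    rw [← range_compressHom hS] at hy
    obtain ⟨a, ha⟩ := hy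
    exact ⟨Ideal.Quotient.mk _ a, Subtype.ext ha⟩

/-- The isomorphism of `C*_{r,0}(I_l(S))` onto `C*_r(S)` under Clifford's condition. -/
noncomputable def quotientEquiv (hS : CliffordCondition S) : redAlgZero S ≃⋆ₐ[ℂ] toeplitzAlg S where
  __ := RingEquiv.ofBijective (quotientHom S) (quotientHom_bijective hS)
  map_star' x := by
    obtain ⟨a, rfl⟩ := Ideal.Quotient.mk_surjective x
    exact Subtype.ext (map_star (compressHom S) a)
  map_smul' c x := by
    obtain ⟨a, rfl⟩ := Ideal.Quotient.mk_surjective x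
    exact Subtype.ext (map_smul (compressHom S) c a)

theorem norm_quotientHom (hS : CliffordCondition S) (x : redAlgZero S) :
    ‖quotientHom S x‖ = ‖x‖ := by
  obtain ⟨a, rfl⟩ := Ideal.Quotient.mk_surjective x
  refine le_antisymm ?_ ?_
  -- The quotient norm is an infimum over representatives, and compression is contractive on each.
  · refine le_of_forall_pos_le_add fun ε hε => ?_
    obtain ⟨b, hb, hlt⟩ := Submodule.Quotient.norm_mk_lt
      (S := zeroIdeal S) (Ideal.Quotient.mk (zeroIdeal S) a) hε
    have hb' : Ideal.Quotient.mk (zeroIdeal S) b = Ideal.Quotient.mk (zeroIdeal S) a := hb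
    rw [← hb']
    refine (norm_compressHom_le b).trans (hlt.le.trans ?_)
    rw [← hb']
  -- The representative orthogonal to the zero attains the infimum.
  · obtain ⟨b, hb, hab⟩ := exists_sub_mem_zeroSpan a
    have hb' : Ideal.Quotient.mk (zeroIdeal S) a = Ideal.Quotient.mk (zeroIdeal S) b :=
      Ideal.Quotient.eq.2 hab
    rw [hb']
    exact (Submodule.Quotient.norm_mk_le (zeroIdeal S) b).trans (norm_le_norm_compressHom hS b hb)

end Regular

end LeftHull

theorem mainTheorem4 (S : Type*) [Monoid S] [IsCancelMul S]
    (hS : LeftHull.CliffordCondition S) :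
    LeftHull.HullEStarUnitary S ∧ LeftHull.IndependentIdeals S ∧
    ∃ h : LeftHull.redAlgZero S ≃⋆ₐ[ℂ] LeftHull.toeplitzAlg S,
      (∀ a : LeftHull.redAlg (LeftHull.leftInverseHull S),
        ((h (Ideal.Quotient.mk (LeftHull.zeroIdeal S) a) : LeftHull.toeplitzAlg S) :
            LeftHull.ell2 S →L[ℂ] LeftHull.ell2 S) =
          (LeftHull.intertwiner S).adjoint ∘L a.1 ∘L LeftHull.intertwiner S) ∧
      (∀ f : LeftHull.leftInverseHull S,
        ((h (LeftHull.regGenZero f) : LeftHull.toeplitzAlg S) :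
            LeftHull.ell2 S →L[ℂ] LeftHull.ell2 S) = LeftHull.omega f) ∧
      (∀ x : LeftHull.redAlgZero S, ‖h x‖ = ‖x‖) :=
  ⟨LeftHull.hullEStarUnitary_of_clifford hS, LeftHull.independentIdeals_of_clifford hS,
    LeftHull.quotientEquiv hS, fun _ => rfl, fun f => LeftHull.compress_regRep f,
    LeftHull.norm_quotientHom hS⟩
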